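/- Let $K,A,B$ be nonempty finite sets (states, actions of player 1, actions of player 2). For $k\in K$ let $M_k\in\mathbb R^{A\times B}$, and for $a\in A$ let $Q_a\in\mathbb R^{K\times K}$ be a stochastic matrix. For $N\ge 1$ and $\alpha\in\mathbb R^K$, the $N$-stage dual game $G_N(\alpha)$ is the following zero-sum game. Player 1 (informed) chooses the law $p\in\Delta(K)$ of the initial state $k_1$; at stage $t\ge 2$ the state $k_t$ has law $Q_{a_{t-1}}(k_{t-1},\cdot)$. At each stage player 1 observes the current state, the two players simultaneously choose $a_t\in A$ and $b_t\in B$, and both then observe $(a_t,b_t)$; player 2 (uninformed) does not observe the states. Player 1 uses a behavior strategy $\sigma=(\sigma_t)_{t\le N}$, $\sigma_t:K^t\times A^{t-1}\times B^{t-1}\to\Delta(A)$, and player 2 a behavior strategy $\tau=(\tau_t)_{t\le N}$, $\tau_t:A^{t-1}\times B^{t-1}\to\Delta(B)$. Player 1 maximizes and player 2 minimizes $$g_N(\alpha;p,\sigma,\tau)=\mathbf E_{p,\sigma,\tau,Q}\Big(\alpha(k_1)+\sum_{t=1}^N M_{k_t}(a_t,b_t)\Big).$$ Let $w_N(\alpha)=\min_\tau\max_{p,\sigma}g_N(\alpha;p,\sigma,\tau)$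 be the value. A strategy $\tau^*$ of player 2 is a security strategy in $G_N(\alpha)$ if $\max_{p,\sigma}g_N(\alpha;p,\sigma,\tau^*)=w_N(\alpha)$. For a vector $\alpha_t\in\mathbb R^K$ and a stage $1\le t\le N$ consider the problem $$\min_{\hat y\in\Delta(B)}\ \min_{(\beta_a\in\mathbb R^{K})_{a\in A}}\ \max_{\Pi\in\Delta(K\times A)}\ \sum_{k\in K,\,a\in A}\Pi(k,a)\big(M_k(a,:)\hat y+\alpha_t(k)-Q_a(k,:)\beta_a+w_{N-t}(\beta_a)\big),\qquad(\ast)$$ where at the last stage $t=N$ the term $-Q_a(k,:)\beta_a+w_{0}(\beta_a)$ is omitted. The regret algorithm for $G_N(\alpha)$ starts with the regret $\alpha_1=\alpha$. At each stage $t=1,\dots,N$ it selects, as a function of $t$ and of the current regret $\alpha_t$, an optimal solution $(\hat y^*,(\beta^*_a)_{a\in A})$ of $(\ast)$; player 2 draws an action according to $\hat y^*$, and after player 1's action $a_t$ is observed the regret is updated to $\alpha_{t+1}=\beta^*_{a_t}$. **Theorem.** For every $N\ge1$ and $\alpha\in\mathbb R^K$: 1. for every $1\le t\le N$ and every $\alpha_t\in\mathbb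 R^K$ the problem $(\ast)$ has an optimal solution, so that the regret algorithm can be carried out; 2. player 2 has a security strategy in $G_N(\alpha)$ whose stage-$t$ mixed action depends only on $t$ and on the current regret $\alpha_t$; 3. such a strategy is constructed by the regret algorithm: whichever optimal solutions are selected, the resulting strategy of player 2 is a security strategy in $G_N(\alpha)$. -/

import Mathlib

noncomputable section

namespace AsymGame

/-- The data of a stochastic game controlled by player 1: for each state `k` a payoff matrix `M k`
(rows: actions of player 1, columns: actions of player 2), and for each action `a` of player 1 a
stochastic transition matrix `Q a`, whose rows are probability vectors on the state set. -/
structure Game (K A B : Type*) [Fintype K] where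
  M : K → A → B → ℝ
  Q : A → K → stdSimplex ℝ K

/-- Behavior strategies of the informed player in the `N`-stage game. Stages are numbered from `0`,
so at stage `t : Fin N` the player knows `t + 1` states and the `t` past actions of both players. -/
abbrev InformedStrategy (K A B : Type*) [Fintype A] (N : ℕ) : Type _ :=
  (t : Fin N) → (Fin (t + 1) → K) → (Fin t → A) → (Fin t → B) → stdSimplex ℝ A

/-- Behavior strategies of the uninformed player in the `N`-stage game: at stage `t : Fin N` the
player knows the `t` past actions of both players, but none of the states. -/
abbrev UninformedStrategy (A B : Type*) [Fintype B] (N : ℕ) : Type _ :=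
  (t : Fin N) → (Fin t → A) → (Fin t → B) → stdSimplex ℝ B

/-- A play: the sequences of states, of actions of player 1 and of actions of player 2. -/
abbrev Play (K A B : Type*) (N : ℕ) : Type _ := (Fin N → K) × (Fin N → A) × (Fin N → B)

variable {K A B : Type*} [Fintype K] [Fintype A] [Fintype B]

namespace Game

variable (G : Game K A B)

/-- The probability of the state at stage `t` of a play given the past of the play: it is drawn
from `p` at the first stage, and from `Q a k` afterwards, where `k` and `a` are the
state and the action of player 1 at the previous stage. -/
def stateProb {N : ℕ} (p : stdSimplex ℝ K) (k : Fin N → K) (a : Fin N → A) (t : Fin N) : ℝ :=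
  if (t : ℕ) = 0 then (p : K → ℝ) (k t)
  else
    let s : Fin N := ⟨(t : ℕ) - 1, lt_of_le_of_lt (Nat.sub_le _ _) t.isLt⟩
    (G.Q (a s) (k s) : K → ℝ) (k t)

/-- The probability of a play when the initial state has law `p` and the players use `σ`, `τ`. -/
def playProb {N : ℕ} (p : stdSimplex ℝ K) (σ : InformedStrategy K A B N)
    (τ : UninformedStrategy A B N) (ω : Play K A B N) : ℝ :=
  ∏ t : Fin N,
    (G.stateProb p ω.1 ω.2.1 t *
      (σ t (fun i => ω.1 (Fin.castLE t.isLt i)) (fun i => ω.2.1 (Fin.castLE t.isLt.le i))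
        (fun i => ω.2.2 (Fin.castLE t.isLt.le i)) : A → ℝ) (ω.2.1 t) *
      (τ t (fun i => ω.2.1 (Fin.castLE t.isLt.le i))
        (fun i => ω.2.2 (Fin.castLE t.isLt.le i)) : B → ℝ) (ω.2.2 t))

/-- The total payoff of player 1 along a play of the dual game: the stage payoffs, and at the first
stage also the entry `α k` of the initial vector payoff, where `k` is the initial state. -/
def playPayoff {N : ℕ} (α : K → ℝ) (ω : Play K A B N) : ℝ :=
  ∑ t : Fin N, ((if (t : ℕ) = 0 then α (ω.1 t) else 0) + G.M (ω.1 t) (ω.2.1 t) (ω.2.2 t))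

/-- The expected total payoff of the `N`-stage dual game. A strategy of player 1 is a pair `x` of
a law `x.1` for the choice of the initial state and a behavior strategy `x.2`. -/
def dualPayoff {N : ℕ} (α : K → ℝ) (x : stdSimplex ℝ K × InformedStrategy K A B N)
    (τ : UninformedStrategy A B N) : ℝ :=
  ∑ ω : Play K A B N, G.playProb x.1 x.2 τ ω * G.playPayoff α ω

/-- The value of the `N`-stage dual game with initial vector payoff `α`, as the security level
(minmax value) of player 2. -/
def dualValue (N : ℕ) (α : K → ℝ) : ℝ :=
  ⨅ τ : UninformedStrategy A B N,
    ⨆ x : stdSimplex ℝ K × InformedStrategy K A B N, G.dualPayoff α x τ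

/-- `τ` is a security strategy of player 2 in the `N`-stage dual game with initial vector payoff
`α`: the maximum over the strategies of player 1 of the payoff against `τ` is the value. -/
def IsDualSecurityStrategy {N : ℕ} (α : K → ℝ) (τ : UninformedStrategy A B N) : Prop :=
  IsGreatest (Set.range fun x : stdSimplex ℝ K × InformedStrategy K A B N => G.dualPayoff α x τ)
    (G.dualValue N α)

/-- The continuation term `w_n(β_a) - Q_a(k,:) β_a` when `n` stages remain after the current one;
it is absent at the last stage. -/
def continuation (n : ℕ) (β : A → K → ℝ) (k : K) (a : A) : ℝ :=
  if n = 0 then 0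
  else G.dualValue n (β a) - ∑ k' : K, (G.Q a k : K → ℝ) k' * β a k'

/-- The inner maximum, over `π ∈ Δ(K × A)`, of the minmax problem at a stage with regret `α` after
which `n` stages remain. -/
def worstCase (n : ℕ) (α : K → ℝ) (y : stdSimplex ℝ B) (β : A → K → ℝ) : ℝ :=
  ⨆ π : stdSimplex ℝ (K × A), ∑ k : K, ∑ a : A, (π : K × A → ℝ) (k, a) *
    ((∑ b : B, G.M k a b * (y : B → ℝ) b) + α k + G.continuation n β k a)

/-- `(y, β)` is an optimal solution of the minmax problem at a stage with regret `α` after which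
`n` stages remain. -/
def IsOptimalSolution (n : ℕ) (α : K → ℝ) (y : stdSimplex ℝ B) (β : A → K → ℝ) : Prop :=
  ∀ (y' : stdSimplex ℝ B) (β' : A → K → ℝ), G.worstCase n α y β ≤ G.worstCase n α y' β'

end Game

/-- A rule that assigns to a stage and a regret a mixed action `y` of player 2 and, for each action
of player 1, the regret `β` at the next stage. -/
structure RegretRule (K A B : Type*) [Fintype B] where
  y : ℕ → (K → ℝ) → stdSimplex ℝ B
  β : ℕ → (K → ℝ) → A → K → ℝ

namespace RegretRule

/-- The regret at stage `t` after the actions `I` of player 1, with regret `α` at the first stage: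
after action `a` at stage `t` the regret is updated to `β t (regret at stage t) a`. -/
def regret (R : RegretRule K A B) (α : K → ℝ) : (t : ℕ) → (Fin t → A) → K → ℝ
  | 0, _ => α
  | t + 1, I => R.β t (R.regret α t fun i => I i.castSucc) (I (Fin.last t))

/-- The strategy of player 2 that plays `y` at the current stage and regret. -/
def strategy (R : RegretRule K A B) (α : K → ℝ) (N : ℕ) : UninformedStrategy A B N :=
  fun t I _ => R.y t (R.regret α t I)

/-- `R` carries out the regret algorithm in the `N`-stage dual game with initial vector payoff `α`:
at every stage, after every sequence of actions of player 1, it selects an optimal solution of the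
minmax problem for the current regret. -/
def IsAlgorithm (G : Game K A B) (N : ℕ) (α : K → ℝ) (R : RegretRule K A B) : Prop :=
  ∀ (t : Fin N) (I : Fin t → A),
    G.IsOptimalSolution (N - (t + 1)) (R.regret α t I)
      (R.y t (R.regret α t I)) (R.β t (R.regret α t I))

end RegretRule

end AsymGame

end

/-!
The theorem is a dynamic programming principle for the dual game, seen from the uninformed player.

Fix a strategy `τ` of player 2. Player 1 then faces a Markov decision problem; let `L τ k`
(`Game.bestReply`) be the most it can obtain from the initial state `k`. It satisfies
`L τ k = max_a ∑_b y(b) (M_k(a,b) + ∑_k' Q_a(k,k') L τ_{ab} k')`, where `y` is the first mixed action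
of `τ` and `τ_{ab}` its continuation. Since player 1 also chooses the initial law, `τ` guarantees
exactly `max_k (α k + L τ k)` (`Game.isGreatest_guarantee`), and the value `w_N(α)` is the minimum
of this quantity over `τ`, attained because the strategy set is compact and `L` is continuous
(`Game.exists_guarantee_isLeast`).

The point is the Bellman equation: `w_{n+1}(α)` is the minimum of the minmax problem of the stage
(`Game.IsOptimalSolution.worstCase_eq`).

* Given `(y, β)`, player 2 may play `y` and then, after the action `a`, optimally in the dual game
  with vector payoff `β_a`. For a continuation `τ'` with `β_a + L τ' ≤ w_n(β_a)` one has
  `L τ' ≤ w_n(β_a) - β_a`, so the guaranteed payoff is at most the objective at `(y, β)`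
  (`Game.guarantee_le_worstCase`).
* Given `τ`, take `y` its first mixed action and `β_a = -∑_b y(b) L τ_{ab}`. The objective at
  `(y, β)` is at most what `τ` guarantees as soon as `w_n(β_a) ≤ 0`
  (`Game.exists_worstCase_le_guarantee`), and this follows from a convexity property: some strategy
  `τ'` has `L τ' ≤ ∑_b y(b) L τ_{ab}` (`Game.exists_bestReply_le_sum`).

An optimal `τ` thus yields an optimal solution of the minmax problem. Conversely, the continuation
of a strategy produced by the regret algorithm is produced by the algorithm from the updated regret,
so by induction on the number of stages the first of the two inequalities shows that the strategy
guarantees the value (`RegretRule.IsAlgorithm.guarantee_strategy_eq`).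
-/

namespace AsymGame

open Finset

/-! ### First stage and continuation of strategies and plays -/

section Combinators

variable {K A B : Type*} {n : ℕ}

/-- The strategy of the informed player for the last `n` stages that `σ` induces after the state
`k` and the actions `a`, `b` at the first stage. -/
def InformedStrategy.tail [Fintype A] (σ : InformedStrategy K A B (n + 1)) (k : K) (a : A) (b : B) :
    InformedStrategy K A B n :=
  fun t hk ha hb => σ t.succ (Fin.cons (α := fun _ => K) k hk) (Fin.cons (α := fun _ => A) a ha)
    (Fin.cons (α := fun _ => B) b hb)

/-- The strategy of the uninformed player for the last `n` stages that `τ` induces after the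
actions `a`, `b` at the first stage. -/
def UninformedStrategy.tail [Fintype B] (τ : UninformedStrategy A B (n + 1)) (a : A) (b : B) :
    UninformedStrategy A B n :=
  fun t ha hb => τ t.succ (Fin.cons (α := fun _ => A) a ha) (Fin.cons (α := fun _ => B) b hb)

/-- The mixed action that `τ` plays at the first stage. -/
def UninformedStrategy.head [Fintype B] (τ : UninformedStrategy A B (n + 1)) : stdSimplex ℝ B :=
  τ 0 Fin.elim0 Fin.elim0

/-- The mixed action that `σ` plays at the first stage in state `k`. -/
def InformedStrategy.head [Fintype A] (σ : InformedStrategy K A B (n + 1)) (k : K) :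
    stdSimplex ℝ A :=
  σ 0 (fun _ => k) Fin.elim0 Fin.elim0

/-- The strategy that plays `x k` at the first stage in state `k` and then follows `σ k a b`. -/
def InformedStrategy.cons [Fintype A] (x : K → stdSimplex ℝ A)
    (σ : K → A → B → InformedStrategy K A B n) : InformedStrategy K A B (n + 1) :=
  Fin.cases (fun hk _ _ => x (hk 0))
    (fun t (hk : Fin (t + 1 + 1) → K) (ha : Fin (t + 1) → A) (hb : Fin (t + 1) → B) =>
      σ (hk 0) (ha 0) (hb 0) t (fun i => hk i.succ) (fun i => ha i.succ) (fun i => hb i.succ))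

/-- The strategy that plays `y` at the first stage and then follows `τ a b`. -/
def UninformedStrategy.cons [Fintype B] (y : stdSimplex ℝ B)
    (τ : A → B → UninformedStrategy A B n) : UninformedStrategy A B (n + 1) :=
  Fin.cases (fun _ _ => y)
    (fun t (ha : Fin (t + 1) → A) (hb : Fin (t + 1) → B) =>
      τ (ha 0) (hb 0) t (fun i => ha i.succ) (fun i => hb i.succ))

@[simp] lemma InformedStrategy.head_cons [Fintype A] (x : K → stdSimplex ℝ A)
    (σ : K → A → B → InformedStrategy K A B n) (k : K) : (cons x σ).head k = x k := rfl

@[simp] lemma InformedStrategy.tail_cons [Fintype A] (x : K → stdSimplex ℝ A)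
    (σ : K → A → B → InformedStrategy K A B n) (k : K) (a : A) (b : B) :
    (cons x σ).tail k a b = σ k a b := rfl

@[simp] lemma UninformedStrategy.head_cons [Fintype B] (y : stdSimplex ℝ B)
    (τ : A → B → UninformedStrategy A B n) : (cons y τ).head = y := rfl

@[simp] lemma UninformedStrategy.tail_cons [Fintype B] (y : stdSimplex ℝ B)
    (τ : A → B → UninformedStrategy A B n) (a : A) (b : B) : (cons y τ).tail a b = τ a b := rfl

/-- The play with first state `k` and first actions `a`, `b`, continued by `ω`. -/
def Play.cons (k : K) (a : A) (b : B) (ω : Play K A B n) : Play K A B (n + 1) :=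
  (Fin.cons (α := fun _ => K) k ω.1, Fin.cons (α := fun _ => A) a ω.2.1,
    Fin.cons (α := fun _ => B) b ω.2.2)

lemma cons_castLE {X : Type*} (x : X) {m : ℕ} (h : Fin n → X) (hm : m ≤ n) :
    (fun i => (Fin.cons (α := fun _ => X) x h : Fin (n + 1) → X)
      (Fin.castLE (Nat.succ_le_succ hm) i)) =
    (Fin.cons (α := fun _ => X) x (fun i => h (Fin.castLE hm i)) : Fin (m + 1) → X) := by
  funext i
  exact Fin.cases rfl (fun i => rfl) i

/-- A play is the triple of its first state and actions, together with its continuation. -/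
def Play.consEquiv : (K × A × B) × Play K A B n ≃ Play K A B (n + 1) where
  toFun x := Play.cons x.1.1 x.1.2.1 x.1.2.2 x.2
  invFun ω := ((ω.1 0, ω.2.1 0, ω.2.2 0), (Fin.tail ω.1, Fin.tail ω.2.1, Fin.tail ω.2.2))
  left_inv x := by simp [Play.cons]
  right_inv ω := by simp [Play.cons]

lemma sum_play_succ [Fintype K] [Fintype A] [Fintype B] (F : Play K A B (n + 1) → ℝ) :
    ∑ ω, F ω = ∑ k, ∑ a, ∑ b, ∑ ω, F (Play.cons k a b ω) := by
  rw [← Play.consEquiv.sum_comp F, Fintype.sum_prod_type, Fintype.sum_prod_type]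
  simp_rw [Fintype.sum_prod_type (α₁ := A)]
  rfl

end Combinators

/-! ### Averages with respect to a probability vector -/

section Simplex

variable {ι : Type*} [Fintype ι]

lemma sum_mul_le_of_forall_le (w : stdSimplex ℝ ι) {f : ι → ℝ} {c : ℝ} (h : ∀ i, f i ≤ c) :
    ∑ i, (w : ι → ℝ) i * f i ≤ c := by
  calc ∑ i, (w : ι → ℝ) i * f i ≤ ∑ i, (w : ι → ℝ) i * c :=
        sum_le_sum fun i _ => mul_le_mul_of_nonneg_left (h i) (stdSimplex.zero_le w i)
    _ = c := by rw [← sum_mul, stdSimplex.sum_eq_one, one_mul]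

lemma sum_mul_mono (w : stdSimplex ℝ ι) {f g : ι → ℝ} (h : ∀ i, f i ≤ g i) :
    ∑ i, (w : ι → ℝ) i * f i ≤ ∑ i, (w : ι → ℝ) i * g i :=
  sum_le_sum fun i _ => mul_le_mul_of_nonneg_left (h i) (stdSimplex.zero_le w i)

lemma sum_mul_const (w : stdSimplex ℝ ι) (c : ℝ) : ∑ i, (w : ι → ℝ) i * c = c := by
  rw [← sum_mul, stdSimplex.sum_eq_one, one_mul]

open Classical in
/-- The point mass at `i`. -/
noncomputable def dirac (i : ι) : stdSimplex ℝ ι := ⟨Pi.single i 1, single_mem_stdSimplex ℝ i⟩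

@[simp] lemma sum_dirac_mul (i : ι) (f : ι → ℝ) :
    ∑ j, (dirac i : ι → ℝ) j * f j = f i := by
  classical
  change ∑ j, (Pi.single i 1 : ι → ℝ) j * f j = f i
  simp [Pi.single_apply]

end Simplex

/-! ### Decomposition of the expected payoff at the first stage -/

namespace Game

variable {K A B : Type*} [Fintype K] [Fintype A] [Fintype B] (G : Game K A B) {n : ℕ}

lemma playProb_cons (p : stdSimplex ℝ K) (σ : InformedStrategy K A B (n + 1))
    (τ : UninformedStrategy A B (n + 1)) (k : K) (a : A) (b : B) (ω : Play K A B n) :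
    G.playProb p σ τ (Play.cons k a b ω) =
      (p : K → ℝ) k * (σ.head k : A → ℝ) a * (τ.head : B → ℝ) b *
        G.playProb (G.Q a k) (σ.tail k a b) (τ.tail a b) ω := by
  simp only [playProb]
  rw [Fin.prod_univ_succ]
  congr 1
  · congr 2
    · congr 1
      refine congr (congr (congrArg (σ 0) ?_) ?_) ?_
      · funext i
        exact Fin.cases rfl (fun i => i.elim0) i
      · funext i
        exact i.elim0
      · funext i
        exact i.elim0
    · refine congr (congrArg (τ 0) ?_) ?_
      · funext i
        exact i.elim0
      · funext i
        exact i.elim0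
  · refine prod_congr rfl fun t _ => ?_
    have hstate : G.stateProb p (Play.cons k a b ω).1 (Play.cons k a b ω).2.1 t.succ =
        G.stateProb (G.Q a k) ω.1 ω.2.1 t := by
      obtain ⟨t, ht⟩ := t
      cases t <;> rfl
    rw [hstate]
    congr 2
    · congr 1
      exact congr (congr (congrArg (σ t.succ) (cons_castLE k ω.1 _)) (cons_castLE a ω.2.1 _))
        (cons_castLE b ω.2.2 _)
    · exact congr (congrArg (τ t.succ) (cons_castLE a ω.2.1 _)) (cons_castLE b ω.2.2 _)

lemma playPayoff_cons {K A B : Type*} [Fintype K] (G : Game K A B) (α : K → ℝ) (k : K) (a : A)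
    (b : B) (ω : Play K A B n) :
    G.playPayoff α (Play.cons k a b ω) = α k + G.M k a b + G.playPayoff 0 ω := by
  simp [playPayoff, Fin.sum_univ_succ, Play.cons]

lemma sum_playProb (p : stdSimplex ℝ K) (σ : InformedStrategy K A B n)
    (τ : UninformedStrategy A B n) : ∑ ω, G.playProb p σ τ ω = 1 := by
  induction n generalizing p with
  | zero => simp [playProb]
  | succ n ih =>
    simp_rw [sum_play_succ, playProb_cons, ← mul_sum, ih, mul_one, ← mul_sum,
      stdSimplex.sum_eq_one, mul_one, ← mul_sum, stdSimplex.sum_eq_one, mul_one,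
      stdSimplex.sum_eq_one]

lemma dualPayoff_zero (α : K → ℝ) (x : stdSimplex ℝ K × InformedStrategy K A B 0)
    (τ : UninformedStrategy A B 0) : G.dualPayoff α x τ = 0 := by
  simp [dualPayoff, playPayoff]

lemma dualPayoff_succ (α : K → ℝ) (p : stdSimplex ℝ K) (σ : InformedStrategy K A B (n + 1))
    (τ : UninformedStrategy A B (n + 1)) :
    G.dualPayoff α (p, σ) τ = ∑ k, (p : K → ℝ) k * ∑ a, (σ.head k : A → ℝ) a *
      ∑ b, (τ.head : B → ℝ) b * (α k + G.M k a b +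
        G.dualPayoff 0 (G.Q a k, σ.tail k a b) (τ.tail a b)) := by
  simp_rw [dualPayoff, sum_play_succ, playProb_cons, playPayoff_cons, mul_sum]
  refine sum_congr rfl fun k _ => sum_congr rfl fun a _ => sum_congr rfl fun b _ => ?_
  simp_rw [mul_assoc, ← mul_sum, mul_add, sum_add_distrib, ← sum_mul, sum_playProb, one_mul]
  ring

lemma dualPayoff_eq_add (α : K → ℝ) (p : stdSimplex ℝ K) (σ : InformedStrategy K A B (n + 1))
    (τ : UninformedStrategy A B (n + 1)) :
    G.dualPayoff α (p, σ) τ = ∑ k, (p : K → ℝ) k * α k + G.dualPayoff 0 (p, σ) τ := by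
  simp_rw [dualPayoff_succ, Pi.zero_apply, add_assoc, zero_add, mul_add, sum_add_distrib, mul_add,
    sum_add_distrib, sum_mul_const, mul_add, sum_add_distrib]

/-! ### Best replies of the informed player -/

section BestReply

variable [Nonempty A]

/-- The largest expected sum of the stage payoffs that the informed player can obtain against `τ`
from the initial state `k`, defined by backward induction on the number of stages. -/
noncomputable def bestReply : {n : ℕ} → UninformedStrategy A B n → K → ℝ
  | 0, _, _ => 0
  | _ + 1, τ, k => univ.sup' univ_nonempty fun a => ∑ b, (τ.head : B → ℝ) b *
      (G.M k a b + ∑ k', (G.Q a k : K → ℝ) k' * bestReply (τ.tail a b) k')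

lemma le_bestReply (τ : UninformedStrategy A B (n + 1)) (k : K) (a : A) :
    ∑ b, (τ.head : B → ℝ) b *
      (G.M k a b + ∑ k', (G.Q a k : K → ℝ) k' * G.bestReply (τ.tail a b) k') ≤
      G.bestReply τ k :=
  le_sup' (fun a => ∑ b, (τ.head : B → ℝ) b *
      (G.M k a b + ∑ k', (G.Q a k : K → ℝ) k' * G.bestReply (τ.tail a b) k')) (mem_univ a)

lemma bestReply_le {τ : UninformedStrategy A B (n + 1)} {k : K} {c : ℝ}
    (h : ∀ a, ∑ b, (τ.head : B → ℝ) b *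
      (G.M k a b + ∑ k', (G.Q a k : K → ℝ) k' * G.bestReply (τ.tail a b) k') ≤ c) :
    G.bestReply τ k ≤ c :=
  sup'_le _ _ fun a _ => h a

lemma dualPayoff_le_sum_bestReply (p : stdSimplex ℝ K) (σ : InformedStrategy K A B n)
    (τ : UninformedStrategy A B n) :
    G.dualPayoff 0 (p, σ) τ ≤ ∑ k, (p : K → ℝ) k * G.bestReply τ k := by
  induction n generalizing p with
  | zero => simp [dualPayoff_zero, bestReply]
  | succ n ih =>
    rw [dualPayoff_succ]
    refine sum_mul_mono _ fun k => sum_mul_le_of_forall_le _ fun a => ?_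
    refine le_trans (sum_mul_mono _ fun b => ?_) (G.le_bestReply τ k a)
    rw [Pi.zero_apply, zero_add]
    gcongr
    exact ih _ _ _

/-- One strategy of the informed player is a best reply to `τ` for all initial laws at once. -/
lemma exists_dualPayoff_eq_sum_bestReply (τ : UninformedStrategy A B n) :
    ∃ σ : InformedStrategy K A B n, ∀ p : stdSimplex ℝ K,
      G.dualPayoff 0 (p, σ) τ = ∑ k, (p : K → ℝ) k * G.bestReply τ k := by
  induction n with
  | zero => exact ⟨fun t => t.elim0, fun p => by simp [dualPayoff_zero, bestReply]⟩
  | succ n ih =>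
    choose σ hσ using fun a b => ih (τ.tail a b)
    have hmax (k : K) := exists_mem_eq_sup' (s := univ) univ_nonempty fun a =>
      ∑ b, (τ.head : B → ℝ) b *
        (G.M k a b + ∑ k', (G.Q a k : K → ℝ) k' * G.bestReply (τ.tail a b) k')
    choose x _ hx using hmax
    refine ⟨.cons (fun k => dirac (x k)) fun _ a b => σ a b, fun p => ?_⟩
    rw [dualPayoff_succ]
    refine sum_congr rfl fun k _ => ?_
    simp only [InformedStrategy.head_cons, InformedStrategy.tail_cons, sum_dirac_mul, hσ,
      Pi.zero_apply, zero_add]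
    rw [bestReply, hx]

lemma continuous_bestReply (k : K) :
    Continuous fun τ : UninformedStrategy A B n => G.bestReply τ k := by
  induction n generalizing k with
  | zero => exact continuous_const
  | succ n ih =>
    have hhead (b : B) :
        Continuous fun τ : UninformedStrategy A B (n + 1) => (τ.head : B → ℝ) b :=
      (continuous_apply b).comp <| continuous_subtype_val.comp <|
        (continuous_apply _).comp <| (continuous_apply _).comp <| continuous_apply _
    have htail (a : A) (b : B) :
        Continuous fun τ : UninformedStrategy A B (n + 1) => τ.tail a b :=
      continuous_pi fun t => continuous_pi fun ha => continuous_pi fun hb =>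
        (continuous_apply _).comp <| (continuous_apply _).comp <| continuous_apply _
    refine Continuous.finset_sup'_apply univ_nonempty fun a _ => ?_
    refine continuous_finsetSum _ fun b _ => (hhead b).mul (continuous_const.add ?_)
    exact continuous_finsetSum _ fun k' _ => continuous_const.mul ((ih k').comp (htail a b))

end BestReply

/-! ### Mixtures of strategies of the uninformed player -/

/-- A mixture of strategies of the uninformed player can be replaced by one strategy against which
no best reply, from any initial state, is better than the average of the best replies against the
strategies that are mixed. At the first stage it plays the average of their mixed actions. Against
the action `a` of the informed player it continues, whatever its own action was, with the same
construction for the mixture over pairs of a component and an own first action. -/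
theorem exists_bestReply_le_sum.{v} {K A : Type*} {B : Type v} [Fintype K] [Fintype A] [Fintype B]
    [Nonempty A] (G : Game K A B) {n : ℕ} {ι : Type v} [Fintype ι] (w : stdSimplex ℝ ι)
    (τ : ι → UninformedStrategy A B n) :
    ∃ τ' : UninformedStrategy A B n, ∀ k,
      G.bestReply τ' k ≤ ∑ i, (w : ι → ℝ) i * G.bestReply (τ i) k := by
  induction n generalizing ι with
  | zero => exact ⟨fun t => t.elim0, fun k => by simp [bestReply]⟩
  | succ n ih =>
    let y : stdSimplex ℝ B := ⟨fun b => ∑ i, (w : ι → ℝ) i * ((τ i).head : B → ℝ) b,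
      fun b => sum_nonneg fun i _ =>
        mul_nonneg (stdSimplex.zero_le w i) (stdSimplex.zero_le (τ i).head b), by
        rw [sum_comm]
        simp_rw [← mul_sum, stdSimplex.sum_eq_one, mul_one, stdSimplex.sum_eq_one]⟩
    let W : stdSimplex ℝ (ι × B) := ⟨fun x => (w : ι → ℝ) x.1 * ((τ x.1).head : B → ℝ) x.2,
      fun x => mul_nonneg (stdSimplex.zero_le w x.1) (stdSimplex.zero_le (τ x.1).head x.2), by
        rw [Fintype.sum_prod_type]
        simp_rw [← mul_sum, stdSimplex.sum_eq_one, mul_one, stdSimplex.sum_eq_one]⟩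
    choose τ' hτ' using fun a => ih W fun x => (τ x.1).tail a x.2
    refine ⟨.cons y fun a _ => τ' a, fun k => G.bestReply_le fun a => ?_⟩
    have hW (k' : K) : G.bestReply (τ' a) k' ≤ ∑ i, (w : ι → ℝ) i *
        ∑ b, ((τ i).head : B → ℝ) b * G.bestReply ((τ i).tail a b) k' := by
      refine (hτ' a k').trans (le_of_eq ?_)
      rw [Fintype.sum_prod_type]
      simp_rw [mul_sum, ← mul_assoc]
      rfl
    have hM : ∑ b, (y : B → ℝ) b * G.M k a b =
        ∑ i, (w : ι → ℝ) i * ∑ b, ((τ i).head : B → ℝ) b * G.M k a b := by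
      change ∑ b, (∑ i, (w : ι → ℝ) i * ((τ i).head : B → ℝ) b) * G.M k a b = _
      simp_rw [sum_mul, mul_sum, mul_assoc]
      exact sum_comm
    have hQ : ∑ k', (G.Q a k : K → ℝ) k' * ∑ i, (w : ι → ℝ) i *
        ∑ b, ((τ i).head : B → ℝ) b * G.bestReply ((τ i).tail a b) k' =
        ∑ i, (w : ι → ℝ) i * ∑ b, ((τ i).head : B → ℝ) b *
          ∑ k', (G.Q a k : K → ℝ) k' * G.bestReply ((τ i).tail a b) k' := by
      simp_rw [mul_sum]
      rw [sum_comm]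
      refine sum_congr rfl fun i _ => ?_
      rw [sum_comm]
      refine sum_congr rfl fun b _ => sum_congr rfl fun k' _ => by ring
    calc ∑ b, (y : B → ℝ) b * (G.M k a b + ∑ k', (G.Q a k : K → ℝ) k' * G.bestReply (τ' a) k')
        = ∑ b, (y : B → ℝ) b * G.M k a b +
            ∑ k', (G.Q a k : K → ℝ) k' * G.bestReply (τ' a) k' := by
          simp_rw [mul_add, sum_add_distrib, sum_mul_const]
      _ ≤ ∑ i, (w : ι → ℝ) i * ∑ b, ((τ i).head : B → ℝ) b * G.M k a b +
            ∑ i, (w : ι → ℝ) i * ∑ b, ((τ i).head : B → ℝ) b *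
              ∑ k', (G.Q a k : K → ℝ) k' * G.bestReply ((τ i).tail a b) k' := by
          rw [← hM, ← hQ]
          exact add_le_add_right (sum_mul_mono _ hW) _
      _ = ∑ i, (w : ι → ℝ) i * ∑ b, ((τ i).head : B → ℝ) b *
            (G.M k a b + ∑ k', (G.Q a k : K → ℝ) k' * G.bestReply ((τ i).tail a b) k') := by
          simp_rw [mul_add, sum_add_distrib, mul_add, sum_add_distrib]
      _ ≤ _ := sum_mul_mono _ fun i => G.le_bestReply (τ i) k a

/-! ### The value of the dual game -/

section Value

variable [Nonempty K] [Nonempty A]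

/-- The payoff that `τ` guarantees in the dual game with initial vector payoff `α`: the informed
player does best to start at a state that maximizes `α k + G.bestReply τ k`. This reading needs at least
one stage: `playPayoff` does not count `α` in a game without stages. -/
noncomputable def guarantee (α : K → ℝ) (τ : UninformedStrategy A B n) : ℝ :=
  univ.sup' univ_nonempty fun k => α k + G.bestReply τ k

lemma le_guarantee (α : K → ℝ) (τ : UninformedStrategy A B n) (k : K) :
    α k + G.bestReply τ k ≤ G.guarantee α τ :=
  le_sup' (fun k => α k + G.bestReply τ k) (mem_univ k)

lemma isGreatest_guarantee (α : K → ℝ) (τ : UninformedStrategy A B (n + 1)) :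
    IsGreatest (Set.range fun x : stdSimplex ℝ K × InformedStrategy K A B (n + 1) =>
      G.dualPayoff α x τ) (G.guarantee α τ) := by
  constructor
  · obtain ⟨σ, hσ⟩ := G.exists_dualPayoff_eq_sum_bestReply τ
    obtain ⟨k, -, hk⟩ := exists_mem_eq_sup' (s := univ) univ_nonempty
      fun k => α k + G.bestReply τ k
    refine ⟨(dirac k, σ), ?_⟩
    simp only [dualPayoff_eq_add G α, hσ, sum_dirac_mul]
    exact hk.symm
  · rintro _ ⟨⟨p, σ⟩, rfl⟩
    simp only [dualPayoff_eq_add G α]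
    refine (add_le_add_right (G.dualPayoff_le_sum_bestReply p σ τ) _).trans ?_
    simp_rw [← sum_add_distrib, ← mul_add]
    exact sum_mul_le_of_forall_le _ (G.le_guarantee α τ)

lemma dualValue_eq_iInf_guarantee (α : K → ℝ) :
    G.dualValue (n + 1) α = ⨅ τ : UninformedStrategy A B (n + 1), G.guarantee α τ :=
  iInf_congr fun τ => (G.isGreatest_guarantee α τ).csSup_eq

lemma isDualSecurityStrategy_of_guarantee_eq {α : K → ℝ} {τ : UninformedStrategy A B (n + 1)}
    (h : G.guarantee α τ = G.dualValue (n + 1) α) : G.IsDualSecurityStrategy α τ := by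
  rw [IsDualSecurityStrategy, ← h]
  exact G.isGreatest_guarantee α τ

variable [Nonempty B]

/-- The minimum in the definition of the value is attained, by compactness of the set of behavior
strategies of the uninformed player. -/
lemma exists_guarantee_isLeast (α : K → ℝ) :
    ∃ τ : UninformedStrategy A B (n + 1), G.guarantee α τ = G.dualValue (n + 1) α ∧
      ∀ τ', G.guarantee α τ ≤ G.guarantee (n := n + 1) α τ' := by
  have hcont : Continuous fun τ : UninformedStrategy A B (n + 1) => G.guarantee α τ :=
    Continuous.finset_sup'_apply univ_nonempty fun k _ =>
      continuous_const.add (G.continuous_bestReply k)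
  obtain ⟨τ, -, hτ⟩ := isCompact_univ.exists_isMinOn Set.univ_nonempty hcont.continuousOn
  have hle (τ') : G.guarantee α τ ≤ G.guarantee (n := n + 1) α τ' := hτ (Set.mem_univ τ')
  refine ⟨τ, ?_, hle⟩
  rw [dualValue_eq_iInf_guarantee]
  exact le_antisymm (le_ciInf hle) (ciInf_le ⟨_, Set.forall_mem_range.2 hle⟩ τ)

lemma dualValue_le_guarantee (α : K → ℝ) (τ : UninformedStrategy A B (n + 1)) :
    G.dualValue (n + 1) α ≤ G.guarantee α τ := by
  obtain ⟨τ', h, hle⟩ := G.exists_guarantee_isLeast (n := n) α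
  exact h ▸ hle τ

end Value

/-! ### The minmax problem of a stage -/

section StageProblem

lemma worstCase_le [Nonempty K] [Nonempty A] {α : K → ℝ} {y : stdSimplex ℝ B} {β : A → K → ℝ}
    {c : ℝ}
    (h : ∀ k a, (∑ b, G.M k a b * (y : B → ℝ) b) + α k + G.continuation n β k a ≤ c) :
    G.worstCase n α y β ≤ c := by
  refine ciSup_le fun π => ?_
  rw [← Fintype.sum_prod_type' fun k a => (π : K × A → ℝ) (k, a) *
    ((∑ b : B, G.M k a b * (y : B → ℝ) b) + α k + G.continuation n β k a)]
  exact sum_mul_le_of_forall_le π fun x => h x.1 x.2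

lemma le_worstCase (α : K → ℝ) (y : stdSimplex ℝ B) (β : A → K → ℝ) (k : K) (a : A) :
    (∑ b, G.M k a b * (y : B → ℝ) b) + α k + G.continuation n β k a ≤ G.worstCase n α y β := by
  have hsum (π : stdSimplex ℝ (K × A)) := Fintype.sum_prod_type' fun k a =>
    (π : K × A → ℝ) (k, a) *
      ((∑ b : B, G.M k a b * (y : B → ℝ) b) + α k + G.continuation n β k a)
  rw [worstCase]
  simp_rw [← hsum]
  refine (le_of_eq ?_).trans (le_ciSup ?_ (dirac (k, a)))
  · exact (sum_dirac_mul (k, a) fun x : K × A =>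
      (∑ b, G.M x.1 x.2 b * (y : B → ℝ) b) + α x.1 + G.continuation n β x.1 x.2).symm
  · obtain ⟨c, hc⟩ := Set.Finite.bddAbove (Set.finite_range fun x : K × A =>
      (∑ b, G.M x.1 x.2 b * (y : B → ℝ) b) + α x.1 + G.continuation n β x.1 x.2)
    exact ⟨c, Set.forall_mem_range.2 fun π => sum_mul_le_of_forall_le π fun x => hc ⟨x, rfl⟩⟩

variable [Nonempty K] [Nonempty A]

/-- A strategy of player 2 whose continuation after `a` is optimal for the vector payoff `β a`
guarantees the objective of the minmax problem at `(τ.head, β)`. -/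
lemma guarantee_le_worstCase (α : K → ℝ) (τ : UninformedStrategy A B (n + 1)) (β : A → K → ℝ)
    (h : n ≠ 0 → ∀ a b, G.guarantee (β a) (τ.tail a b) ≤ G.dualValue n (β a)) :
    G.guarantee α τ ≤ G.worstCase n α τ.head β := by
  refine sup'_le _ _ fun k _ => ?_
  rw [← le_sub_iff_add_le']
  refine G.bestReply_le fun a => ?_
  have hcont (b : B) : ∑ k', (G.Q a k : K → ℝ) k' * G.bestReply (τ.tail a b) k' ≤
      G.continuation n β k a := by
    cases n with
    | zero => simp [bestReply, continuation]
    | succ n =>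
      rw [continuation, if_neg n.succ_ne_zero, ← sum_mul_const (G.Q a k) (G.dualValue _ _),
        ← sum_sub_distrib]
      simp_rw [← mul_sub]
      refine sum_mul_mono _ fun k' => ?_
      have := (G.le_guarantee (β a) (τ.tail a b) k').trans (h n.succ_ne_zero a b)
      linarith
  calc ∑ b, (τ.head : B → ℝ) b *
        (G.M k a b + ∑ k', (G.Q a k : K → ℝ) k' * G.bestReply (τ.tail a b) k')
      ≤ ∑ b, (τ.head : B → ℝ) b * (G.M k a b + G.continuation n β k a) :=
        sum_mul_mono _ fun b => by gcongr; exact hcont b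
    _ = ∑ b, G.M k a b * (τ.head : B → ℝ) b + G.continuation n β k a := by
        simp_rw [mul_add, sum_add_distrib, sum_mul_const, mul_comm]
    _ ≤ G.worstCase n α τ.head β - α k := by
        linarith [G.le_worstCase (n := n) α τ.head β k a]

variable [Nonempty B]

/-- Every strategy `τ` of player 2 guarantees at least the objective of the minmax problem at its
first mixed action and a suitable `β`: minus the average of the best replies against the
continuations of `τ`. With this `β a` player 2 guarantees `0` in the continuation game, by mixing
the continuations of `τ` after the action `a`. -/
lemma exists_worstCase_le_guarantee (α : K → ℝ) (τ : UninformedStrategy A B (n + 1)) :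
    ∃ β : A → K → ℝ, G.worstCase n α τ.head β ≤ G.guarantee α τ := by
  refine ⟨fun a k => -∑ b, (τ.head : B → ℝ) b * G.bestReply (τ.tail a b) k,
    G.worstCase_le fun k a => ?_⟩
  set β : A → K → ℝ := fun a k => -∑ b, (τ.head : B → ℝ) b * G.bestReply (τ.tail a b) k with hβ
  have hcont : G.continuation n β k a ≤
      ∑ b, (τ.head : B → ℝ) b * ∑ k', (G.Q a k : K → ℝ) k' * G.bestReply (τ.tail a b) k' := by
    cases n with
    | zero => simp [continuation, bestReply]
    | succ n =>
      obtain ⟨τ', hτ'⟩ := G.exists_bestReply_le_sum τ.head fun b => τ.tail a b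
      have h0 : G.dualValue (n + 1) (β a) ≤ 0 :=
        (G.dualValue_le_guarantee (β a) τ').trans <| sup'_le _ _ fun k' _ => by
          have := hτ' k'
          simp only [hβ]
          linarith
      have hswap : ∑ k', (G.Q a k : K → ℝ) k' * β a k' = -∑ b, (τ.head : B → ℝ) b *
          ∑ k', (G.Q a k : K → ℝ) k' * G.bestReply (τ.tail a b) k' := by
        simp_rw [hβ, mul_neg, sum_neg_distrib, mul_sum]
        rw [sum_comm]
        simp_rw [mul_left_comm]
      rw [continuation, if_neg n.succ_ne_zero, hswap]
      linarith
  have h1 := G.le_bestReply τ k a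
  have h2 := G.le_guarantee α τ k
  simp_rw [mul_add, sum_add_distrib, mul_comm _ (G.M k a _)] at h1
  linarith

/-- The value is at most the objective of the minmax problem at any of its feasible points. -/
lemma dualValue_le_worstCase (α : K → ℝ) (y : stdSimplex ℝ B) (β : A → K → ℝ) :
    G.dualValue (n + 1) α ≤ G.worstCase n α y β := by
  have hopt (a : A) : ∃ τ : UninformedStrategy A B n,
      n ≠ 0 → G.guarantee (β a) τ ≤ G.dualValue n (β a) := by
    cases n with
    | zero => exact ⟨fun t => t.elim0, fun h => absurd rfl h⟩
    | succ n =>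
      obtain ⟨τ, h, -⟩ := G.exists_guarantee_isLeast (n := n) (β a)
      exact ⟨τ, fun _ => h.le⟩
  choose τ hτ using hopt
  exact (G.dualValue_le_guarantee α (.cons y fun a _ => τ a)).trans
    (G.guarantee_le_worstCase α (.cons y fun a _ => τ a) β fun h a _ => hτ a h)

lemma exists_worstCase_le_dualValue (α : K → ℝ) :
    ∃ (y : stdSimplex ℝ B) (β : A → K → ℝ), G.worstCase n α y β ≤ G.dualValue (n + 1) α := by
  obtain ⟨τ, h, -⟩ := G.exists_guarantee_isLeast (n := n) α
  obtain ⟨β, hβ⟩ := G.exists_worstCase_le_guarantee α τ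
  exact ⟨τ.head, β, h ▸ hβ⟩

lemma exists_isOptimalSolution (n : ℕ) (α : K → ℝ) :
    ∃ (y : stdSimplex ℝ B) (β : A → K → ℝ), G.IsOptimalSolution n α y β := by
  obtain ⟨y, β, h⟩ := G.exists_worstCase_le_dualValue (n := n) α
  exact ⟨y, β, fun y' β' => h.trans (G.dualValue_le_worstCase α y' β')⟩

/-- The Bellman equation of the dual game: the value with one more stage is the minimum of the
minmax problem. -/
lemma IsOptimalSolution.worstCase_eq {α : K → ℝ} {y : stdSimplex ℝ B} {β : A → K → ℝ}
    (h : G.IsOptimalSolution n α y β) : G.worstCase n α y β = G.dualValue (n + 1) α := by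
  obtain ⟨y', β', h'⟩ := G.exists_worstCase_le_dualValue (n := n) α
  exact le_antisymm ((h y' β').trans h') (G.dualValue_le_worstCase α y β)

end StageProblem

end Game

/-! ### The regret algorithm -/

namespace RegretRule

/-- The rule `R` started at its second stage. -/
def shift {K A B : Type*} [Fintype B] (R : RegretRule K A B) : RegretRule K A B :=
  ⟨fun t => R.y (t + 1), fun t => R.β (t + 1)⟩

lemma regret_shift {K A B : Type*} [Fintype B] (R : RegretRule K A B) (α : K → ℝ) (t : ℕ)
    (I : Fin (t + 1) → A) :
    R.regret α (t + 1) I = R.shift.regret (R.β 0 α (I 0)) t fun i => I i.succ := by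
  induction t with
  | zero => rfl
  | succ t ih => exact congrArg (fun α' => R.β (t + 1) α' (I (Fin.last (t + 1)))) (ih _)

lemma strategy_tail {K A B : Type*} [Fintype B] (R : RegretRule K A B) (α : K → ℝ) (n : ℕ)
    (a : A) (b : B) : (R.strategy α (n + 1)).tail a b = R.shift.strategy (R.β 0 α a) n := by
  funext t I J
  exact congrArg (R.y (t + 1)) (R.regret_shift α t (Fin.cons (α := fun _ => A) a I))

variable {K A B : Type*} [Fintype K] [Fintype A] [Fintype B] {G : Game K A B}

lemma IsAlgorithm.shift {n : ℕ} {α : K → ℝ} {R : RegretRule K A B}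
    (h : R.IsAlgorithm G (n + 1) α) (a : A) : R.shift.IsAlgorithm G n (R.β 0 α a) := by
  intro t I
  have := h t.succ (Fin.cons (α := fun _ => A) a I)
  have hreg : R.regret α t.succ (Fin.cons (α := fun _ => A) a I) =
      R.shift.regret (R.β 0 α a) t I :=
    R.regret_shift α t (Fin.cons (α := fun _ => A) a I)
  rw [hreg, Fin.val_succ, Nat.add_sub_add_right] at this
  exact this

theorem IsAlgorithm.guarantee_strategy_eq [Nonempty K] [Nonempty A] [Nonempty B] {n : ℕ}
    {α : K → ℝ} {R : RegretRule K A B} (h : R.IsAlgorithm G (n + 1) α) :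
    G.guarantee α (R.strategy α (n + 1)) = G.dualValue (n + 1) α := by
  refine le_antisymm ?_ (G.dualValue_le_guarantee _ _)
  induction n generalizing α R with
  | zero =>
    refine (G.guarantee_le_worstCase α _ (R.β 0 α) fun h => absurd rfl h).trans ?_
    exact (Game.IsOptimalSolution.worstCase_eq G (h 0 Fin.elim0)).le
  | succ n ih =>
    refine (G.guarantee_le_worstCase α _ (R.β 0 α) fun _ a b => ?_).trans ?_
    · -- The continuation is produced by the algorithm from the updated regret.
      rw [strategy_tail]
      exact ih (h.shift a)
    · exact (Game.IsOptimalSolution.worstCase_eq G (h 0 Fin.elim0)).le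

end RegretRule

end AsymGame

theorem mainTheorem1 {K A B : Type*} [Fintype K] [Fintype A] [Fintype B]
    [Nonempty K] [Nonempty A] [Nonempty B]
    (G : AsymGame.Game K A B) (N : ℕ) (hN : 1 ≤ N) (α : K → ℝ) :
    -- the minmax problem of each stage has an optimal solution, whatever the regret
    (∀ (t : Fin N) (α' : K → ℝ), ∃ (y : stdSimplex ℝ B) (β : A → K → ℝ),
      G.IsOptimalSolution (N - (t + 1)) α' y β) ∧
    -- there is a security strategy that depends only on the stage and the current regret
    (∃ R : AsymGame.RegretRule K A B, R.IsAlgorithm G N α ∧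
      ∃ τ : AsymGame.UninformedStrategy A B N, G.IsDualSecurityStrategy α τ ∧
        ∃ f : Fin N → (K → ℝ) → stdSimplex ℝ B,
          ∀ (t : Fin N) (I : Fin t → A) (J : Fin t → B), τ t I J = f t (R.regret α t I)) ∧
    -- every strategy produced by the algorithm is a security strategy
    (∀ R : AsymGame.RegretRule K A B, R.IsAlgorithm G N α →
      G.IsDualSecurityStrategy α (R.strategy α N)) := by
  obtain ⟨n, rfl⟩ := Nat.exists_eq_add_of_le' hN
  have hsec : ∀ R : AsymGame.RegretRule K A B, R.IsAlgorithm G (n + 1) α →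
      G.IsDualSecurityStrategy α (R.strategy α (n + 1)) := fun R hR =>
    G.isDualSecurityStrategy_of_guarantee_eq hR.guarantee_strategy_eq
  refine ⟨fun t α' => G.exists_isOptimalSolution _ α', ?_, hsec⟩
  choose y β hyβ using fun (t : ℕ) (α' : K → ℝ) =>
    G.exists_isOptimalSolution (n + 1 - (t + 1)) α'
  have hR : (⟨y, β⟩ : AsymGame.RegretRule K A B).IsAlgorithm G (n + 1) α :=
    fun t I => hyβ t _
  exact ⟨⟨y, β⟩, hR, _, hsec _ hR, fun t => y t, fun t I J => rfl⟩
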